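/- Let $\mathcal W$ (parameters), $\mathcal X$ (observations) and $\hat{\mathcal W}$ (estimates) be measurable spaces, let $\mathcal P_W$ be a prior probability measure on $\mathcal W$, let $\mathcal P_{X|W}$ be a Markov kernel from $\mathcal W$ to $\mathcal X$, and let $\ell:\mathcal W\times\hat{\mathcal W}\to[0,\infty)$ be a measurable loss. Let $\mathcal P_{WX}$ be the joint law of $(W,X)$, with marginals $\mathcal P_W,\mathcal P_X$. For a measurable estimator $\phi:\mathcal X\to\hat{\mathcal W}$ put $\hat W=\phi(X)$. The Bayes risk is $R_B=\inf_{\phi}\mathbb E[\ell(W,\phi(X))]\in[0,\infty]$, the infimum being over all measurable $\phi:\mathcal X\to\hat{\mathcal W}$, and the small-ball probability is $L_W(\rho)=\sup_{\hat w\in\hat{\mathcal W}}\mathcal P_W(\ell(W,\hat w)<\rho)$. For $p>1$, the Hellinger $p$-mutual information of a pair $(U,V)$ with joint law $\mathcal P_{UV}$ is $\mathcal H_p(U,V)=D_{\varphi}(\mathcal P_{UV}\|\mathcal P_U\mathcal P_V)$ with $\varphi(x)=\frac{x^p-1}{p-1}$, where, for probability measures $P,Q$ with densities $f,g$ with respect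 to a dominating measure $\mu$, $D_\varphi(P\|Q)=\int g\,\varphi(f/g)\,d\mu\in(-\infty,\infty]$, with the usual convention $0\cdot\varphi(a/0)=a\lim_{t\to\infty}\varphi(t)/t$. (So $\mathcal H_p(U,V)=\infty$ unless $\mathcal P_{UV}\ll\mathcal P_U\mathcal P_V$.) Rényi's divergence of order $p$ is $D_p(P\|Q)=\frac1{p-1}\log\int f^p g^{1-p}\,d\mu$, where the integrand is $\infty$ on $\{g=0<f\}$ and $0$ on $\{f=0\}$. Let $p>1$ and $\rho>0$, and assume that $L_W(\rho)>0$ or $\mathcal P_{WX}\ll\mathcal P_W\mathcal P_X$. Then, with the convention $0\cdot\infty=0$ and with right-hand sides taking values in $[-\infty,\infty)$, $$R_B\ \ge\ \rho\left(1-L_W(\rho)^{\frac{p-1}{p}}\,\big((p-1)\,\mathcal H_p(W,X)+1\big)^{\frac1p}\right)$$ and, equivalently in terms of Rényi's divergence, $$R_B\ \ge\ \rho\left(1-L_W(\rho)^{\frac{p-1}{p}}\exp\left(\tfrac{p-1}{p}\,D_p(\mathcal P_{WX}\|\mathcal P_W\mathcal P_X)\right)\right).$$ Moreover, for every measurable estimator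 $\hat W=\phi(X)$, the expected loss $\mathbb E[\ell(W,\hat W)]$ is at least each of the two right-hand sides with $X$ replaced by $\hat W$, that is, at least $$\rho\left(1-L_W(\rho)^{\frac{p-1}{p}}\big((p-1)\mathcal H_p(W,\hat W)+1\big)^{\frac1p}\right)\quad\text{and}\quad\rho\left(1-L_W(\rho)^{\frac{p-1}{p}}\exp\left(\tfrac{p-1}{p}D_p(\mathcal P_{W\hat W}\|\mathcal P_W\mathcal P_{\hat W})\right)\right).$$ -/

import Mathlib

open MeasureTheory ProbabilityTheory Filter
open scoped ENNReal NNReal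

namespace BayesLower

noncomputable section

/-! ### Information measures -/

/-- The slope at infinity `lim_{t → ∞} φ(t) / t` of a function `φ` on `[0, ∞)`. For a convex `φ` the
limit exists in `(-∞, +∞]`, and the upper limit below is that limit. -/
def slopeAtTop (φ : ℝ → ℝ) : EReal :=
  limsup (fun t : ℝ => ((φ t / t : ℝ) : EReal)) atTop

/-- The `φ`-divergence `D_φ(P‖Q) = ∫ q φ(p / q) dμ` of two probability measures, for `φ` convex on
`[0, ∞)`, where `p`, `q` are the densities with respect to any dominating measure `μ`, with the usual
convention `0 φ(p / 0) = p * lim_{t → ∞} φ(t) / t`.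

The part of the integral over `{q > 0}` is `∫ φ(dP/dQ) dQ`. A convex `φ` has an affine minorant, so
the negative part of the integrand is integrable, and the integral is `+∞` when the integrand is not
integrable. The part over `{q = 0}` is the slope at infinity times the mass of the singular part of
`P`; it vanishes when `P ≪ Q`. -/
def phiDiv {Ω : Type*} [MeasurableSpace Ω] (φ : ℝ → ℝ) (P Q : Measure Ω) : EReal :=
  open Classical in
  (if Integrable (fun x => φ (P.rnDeriv Q x).toReal) Q
    then ((∫ x, φ (P.rnDeriv Q x).toReal ∂Q : ℝ) : EReal) else ⊤)
  + slopeAtTop φ * ((P.singularPart Q Set.univ : ℝ≥0∞) : EReal)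

/-- The `φ`-mutual information `I_φ(X, Y) = D_φ(P_{XY}‖P_X P_Y)` of a pair with joint law `P_{XY}`. -/
def phiMutualInfo {A B : Type*} [MeasurableSpace A] [MeasurableSpace B]
    (φ : ℝ → ℝ) (PXY : Measure (A × B)) : EReal :=
  phiDiv φ PXY (PXY.fst.prod PXY.snd)

/-- The function `x ↦ (x ^ p - 1) / (p - 1)`, which generates the Hellinger `p`-divergence. -/
def hellingerFun (p : ℝ) (x : ℝ) : ℝ := (x ^ p - 1) / (p - 1)

/-- The Hellinger `p`-mutual information `H_p(X, Y)` of a pair with joint law `P_{XY}`. -/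
def hellingerInfo {A B : Type*} [MeasurableSpace A] [MeasurableSpace B]
    (p : ℝ) (PXY : Measure (A × B)) : EReal :=
  phiMutualInfo (hellingerFun p) PXY

/-- Rényi's `α`-divergence `D_α(P‖Q) = 1 / (α - 1) * log ∫ p ^ α q ^ (1 - α) dμ`, with the densities
`p`, `q` taken with respect to `μ = P + Q`. For `α > 1` the arithmetic of `[0, ∞]` makes the integrand
`∞` where `q = 0 < p`. -/
def renyiDiv {Ω : Type*} [MeasurableSpace Ω] (α : ℝ) (P Q : Measure Ω) : EReal :=
  ((1 / (α - 1) : ℝ) : EReal) *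
    ENNReal.log (∫⁻ x, (P.rnDeriv (P + Q) x) ^ α * (Q.rnDeriv (P + Q) x) ^ (1 - α) ∂(P + Q))

/-- Rényi's divergence `D_α(P_{XY}‖P_X P_Y)` for a pair with joint law `P_{XY}`. -/
def renyiInfo {A B : Type*} [MeasurableSpace A] [MeasurableSpace B]
    (α : ℝ) (PXY : Measure (A × B)) : EReal :=
  renyiDiv α PXY (PXY.fst.prod PXY.snd)

/-! ### The Bayesian framework -/

section Framework

variable {𝓦 𝓧 𝓥 : Type*} [MeasurableSpace 𝓦] [MeasurableSpace 𝓧] [MeasurableSpace 𝓥]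

/-- The joint law of the parameter `W ∼ P_W` and the observation `X ∼ P_{X|W}`. -/
def jointLaw (PW : Measure 𝓦) (κ : Kernel 𝓦 𝓧) : Measure (𝓦 × 𝓧) := PW ⊗ₘ κ

/-- The joint law of `(W, φ(X))` for the estimator `φ`. -/
def estimatorLaw (PW : Measure 𝓦) (κ : Kernel 𝓦 𝓧) (φ : 𝓧 → 𝓥) : Measure (𝓦 × 𝓥) :=
  (jointLaw PW κ).map (fun z => (z.1, φ z.2))

/-- The expected loss of the estimator `φ`. -/
def estimatorRisk (PW : Measure 𝓦) (κ : Kernel 𝓦 𝓧) (ℓ : 𝓦 × 𝓥 → ℝ≥0) (φ : 𝓧 → 𝓥) : ℝ≥0∞ :=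
  ∫⁻ z, (ℓ (z.1, φ z.2) : ℝ≥0∞) ∂(jointLaw PW κ)

/-- The Bayes risk `R_B`: the infimum of the expected loss over all (measurable) estimators
`φ : 𝓧 → 𝓥`. Estimators are functions of the observation, not randomised ones. -/
def bayesRiskDet (PW : Measure 𝓦) (κ : Kernel 𝓦 𝓧) (ℓ : 𝓦 × 𝓥 → ℝ≥0) : ℝ≥0∞ :=
  ⨅ (φ : 𝓧 → 𝓥) (_ : Measurable φ), estimatorRisk PW κ ℓ φ

/-- The small-ball probability `L_W(ρ) = sup_v P_W(ℓ(W, v) < ρ)`. -/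
def smallBall (PW : Measure 𝓦) (ℓ : 𝓦 × 𝓥 → ℝ≥0) (ρ : ℝ) : ℝ≥0∞ :=
  ⨆ v : 𝓥, PW {w | (ℓ (w, v) : ℝ) < ρ}

end Framework

/-- The value `ρ (1 - L ^ ((p - 1) / p) * ((p - 1) H + 1) ^ (1 / p))`, in `[-∞, ∞)`, where `L` is a
probability and `H` the Hellinger `p`-mutual information. The quantity `(p - 1) H + 1` is nonnegative,
being `∫ (dP/dQ) ^ p dQ` or `∞`. The product of `0` and `∞` is `0`. -/
def hellingerBound (p ρ : ℝ) (L : ℝ≥0∞) (H : EReal) : EReal :=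
  (ρ : EReal) * (1 - ((L ^ ((p - 1) / p) *
    ((((p - 1 : ℝ) : EReal) * H + 1).toENNReal) ^ (1 / p) : ℝ≥0∞) : EReal))

/-- The value `ρ (1 - L ^ ((α - 1) / α) * exp ((α - 1) / α * D))`, in `[-∞, ∞)`. The product of `0`
and `∞` is `0`. -/
def renyiBound (α ρ : ℝ) (L : ℝ≥0∞) (D : EReal) : EReal :=
  (ρ : EReal) * (1 - ((L ^ ((α - 1) / α) *
    EReal.exp ((((α - 1) / α : ℝ) : EReal) * D) : ℝ≥0∞) : EReal))

end

end BayesLower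

/-! The Hellinger and the Rényi information are both functions of the Hellinger integral
`∫ f ^ p g ^ (1 - p) dμ`, and this makes the two bounds equal. Hölder's inequality compares the
joint law `P` with the product `Q` of its marginals on an event `E`:
`P E ≤ Q E ^ ((p - 1) / p) * (∫ f ^ p g ^ (1 - p) dμ) ^ (1 / p)`. Take for `E` the event that the
loss is less than `ρ`. Under `Q` the estimate is independent of `W`, so `Q E ≤ L_W(ρ)`, and Markov's
inequality turns the bound on `P E` into one on the expected loss. The bounds in terms of
`Ŵ = φ(X)` are those for the observation `φ(X)`, whose kernel is `κ.map φ`, and the identity as its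
estimator. -/

namespace BayesLower

section Divergences

variable {Ω : Type*} [MeasurableSpace Ω] {p : ℝ} {P Q : Measure Ω}

/-- The Hellinger integral `∫ f ^ p g ^ (1 - p) dμ` of order `p`, through which the Hellinger and
the Rényi divergence are both expressed. As in `renyiDiv`, the dominating measure is `μ = P + Q`. -/
noncomputable def hellingerIntegral (p : ℝ) (P Q : Measure Ω) : ℝ≥0∞ :=
  ∫⁻ x, P.rnDeriv (P + Q) x ^ p * Q.rnDeriv (P + Q) x ^ (1 - p) ∂(P + Q)

lemma withDensity_absolutelyContinuous_withDensity {μ : Measure Ω} {f g : Ω → ℝ≥0∞}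
    (hg : Measurable g) (h : ∀ᵐ x ∂μ, g x = 0 → f x = 0) :
    μ.withDensity f ≪ μ.withDensity g := by
  refine Measure.AbsolutelyContinuous.mk fun s hs hgs => ?_
  rw [withDensity_apply _ hs, setLIntegral_eq_zero_iff hs hg] at hgs
  rw [withDensity_apply _ hs]
  refine lintegral_eq_zero_of_ae_eq_zero ((ae_restrict_iff' hs).2 ?_)
  filter_upwards [h, hgs] with x hx hgx hxs using hx (hgx hxs)

lemma absolutelyContinuous_of_hellingerIntegral_ne_top [SigmaFinite P] [SigmaFinite Q] (hp : 1 < p)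
    (h : hellingerIntegral p P Q ≠ ∞) : P ≪ Q := by
  have density_zero : ∀ᵐ x ∂(P + Q), Q.rnDeriv (P + Q) x = 0 → P.rnDeriv (P + Q) x = 0 := by
    filter_upwards [ae_lt_top (by fun_prop) h] with x hx hQx
    by_contra hPx
    rw [hQx, ENNReal.zero_rpow_of_neg (by linarith), ENNReal.mul_top] at hx
    · exact hx.ne rfl
    · simp [ENNReal.rpow_eq_zero_iff, hPx, (zero_lt_one.trans hp).le]
  have := withDensity_absolutelyContinuous_withDensity (by fun_prop) density_zero
  rwa [Measure.withDensity_rnDeriv_eq P _ (Measure.le_add_right le_rfl).absolutelyContinuous,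
    Measure.withDensity_rnDeriv_eq Q _ (Measure.le_add_left le_rfl).absolutelyContinuous] at this

lemma hellingerIntegral_eq_lintegral_rnDeriv_rpow [SigmaFinite P] [SigmaFinite Q] (hp : 0 < p)
    (hPQ : P ≪ Q) : hellingerIntegral p P Q = ∫⁻ x, P.rnDeriv Q x ^ p ∂Q := by
  have hQ : Q ≪ P + Q := (Measure.le_add_left le_rfl).absolutelyContinuous
  rw [← lintegral_rnDeriv_mul hQ (by fun_prop), hellingerIntegral]
  refine lintegral_congr_ae ?_
  filter_upwards [Measure.rnDeriv_mul_rnDeriv (κ := P + Q) hPQ, Q.rnDeriv_ne_top (P + Q)]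
    with x chain_rule hg
  rw [← chain_rule, Pi.mul_apply, ENNReal.mul_rpow_of_nonneg _ _ hp.le]
  by_cases hg0 : Q.rnDeriv (P + Q) x = 0
  · simp [hg0, hp]
  · rw [mul_assoc, ← ENNReal.rpow_add _ _ hg0 hg, add_sub_cancel, ENNReal.rpow_one, mul_comm]

lemma slopeAtTop_hellingerFun (hp : 1 < p) : slopeAtTop (hellingerFun p) = ⊤ := by
  have hp1 : 0 < p - 1 := sub_pos.2 hp
  have minorant_atTop : Tendsto (fun t : ℝ => (t ^ (p - 1) - 1) / (p - 1)) atTop atTop :=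
    (tendsto_atTop_add_const_right _ (-1) (tendsto_rpow_atTop hp1)).atTop_div_const hp1
  refine Tendsto.limsup_eq (EReal.tendsto_coe_nhds_top_iff.2 ?_)
  refine tendsto_atTop_mono' _ ?_ minorant_atTop
  filter_upwards [eventually_ge_atTop 1] with t ht
  have ht0 : 0 < t := by linarith
  rw [hellingerFun, div_right_comm, sub_div _ _ t, ← Real.rpow_sub_one ht0.ne']
  gcongr
  exact (div_le_one ht0).2 ht

lemma phiDiv_hellingerFun_of_not_absolutelyContinuous [P.HaveLebesgueDecomposition Q]
    (hp : 1 < p) (hPQ : ¬ P ≪ Q) : phiDiv (hellingerFun p) P Q = ⊤ := by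
  have singular_mass_pos : (0 : EReal) < ((P.singularPart Q Set.univ : ℝ≥0∞) : EReal) := by
    simpa [pos_iff_ne_zero, Measure.singularPart_eq_zero] using hPQ
  rw [phiDiv, slopeAtTop_hellingerFun hp, EReal.top_mul_of_pos singular_mass_pos]
  split_ifs
  · exact EReal.coe_add_top _
  · rfl

lemma phiDiv_of_absolutelyContinuous [P.HaveLebesgueDecomposition Q] (φ : ℝ → ℝ)
    (hPQ : P ≪ Q) [Decidable (Integrable (fun x => φ (P.rnDeriv Q x).toReal) Q)] :
    phiDiv φ P Q = if Integrable (fun x => φ (P.rnDeriv Q x).toReal) Q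
      then ((∫ x, φ (P.rnDeriv Q x).toReal ∂Q : ℝ) : EReal) else ⊤ := by
  simp [phiDiv, (Measure.singularPart_eq_zero P Q).2 hPQ]

lemma hellingerFun_toReal (p : ℝ) (a : ℝ≥0∞) :
    hellingerFun p a.toReal = ((a ^ p).toReal - 1) / (p - 1) := by
  rw [hellingerFun, ENNReal.toReal_rpow]

lemma integrable_hellingerFun_toReal_iff [IsFiniteMeasure Q] (hp0 : 0 ≤ p) (hp1 : p ≠ 1)
    {f : Ω → ℝ≥0∞} (hf : AEMeasurable f Q) (hf_top : ∀ᵐ x ∂Q, f x ≠ ∞) :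
    Integrable (fun x => hellingerFun p (f x).toReal) Q ↔ ∫⁻ x, f x ^ p ∂Q ≠ ∞ := by
  have hfp_top : ∀ᵐ x ∂Q, f x ^ p ≠ ∞ := by
    filter_upwards [hf_top] with x hx using ENNReal.rpow_ne_top_of_nonneg hp0 hx
  have unit : IsUnit (p - 1)⁻¹ := by simpa [sub_eq_zero] using hp1
  simp_rw [hellingerFun_toReal, div_eq_mul_inv]
  rw [integrable_mul_const_iff unit, ← integrable_toReal_iff (hf.pow_const p) hfp_top]
  simp_rw [sub_eq_add_neg]
  exact integrable_add_iff_integrable_left' (integrable_const _)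

lemma mul_integral_hellingerFun_toReal_add_one [IsProbabilityMeasure Q] (hp : p ≠ 1)
    {f : Ω → ℝ≥0∞} (hf : AEMeasurable f Q) (hfp : ∫⁻ x, f x ^ p ∂Q ≠ ∞) :
    (p - 1) * ∫ x, hellingerFun p (f x).toReal ∂Q + 1 = (∫⁻ x, f x ^ p ∂Q).toReal := by
  have hfp_meas : AEMeasurable (fun x => f x ^ p) Q := hf.pow_const p
  have integral_sub_one : ∫ x, ((f x ^ p).toReal - 1) ∂Q = (∫⁻ x, f x ^ p ∂Q).toReal - 1 := by
    rw [integral_sub (integrable_toReal_of_lintegral_ne_top hfp_meas hfp) (integrable_const _),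
      integral_toReal hfp_meas (ae_lt_top' hfp_meas hfp)]
    simp
  simp_rw [hellingerFun_toReal]
  rw [integral_div, integral_sub_one, mul_div_cancel₀ _ (sub_ne_zero.2 hp), sub_add_cancel]

lemma mul_phiDiv_hellingerFun_add_one [SigmaFinite P] [IsProbabilityMeasure Q] (hp : 1 < p) :
    ((p - 1 : ℝ) : EReal) * phiDiv (hellingerFun p) P Q + 1 = hellingerIntegral p P Q := by
  classical
  have hp1 : 0 < p - 1 := sub_pos.2 hp
  by_cases hPQ : P ≪ Q
  · have hf := (P.measurable_rnDeriv Q).aemeasurable (μ := Q)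
    have hf_top := P.rnDeriv_ne_top Q
    rw [phiDiv_of_absolutelyContinuous _ hPQ,
      hellingerIntegral_eq_lintegral_rnDeriv_rpow (by linarith) hPQ,
      integrable_hellingerFun_toReal_iff (by linarith) hp.ne' hf hf_top]
    split_ifs with hfin
    · rw [← EReal.coe_ennreal_toReal hfin,
        ← mul_integral_hellingerFun_toReal_add_one hp.ne' hf hfin]
      push_cast
      rfl
    · rw [not_not.1 hfin, EReal.coe_mul_top_of_pos hp1]
      rfl
  · rw [phiDiv_hellingerFun_of_not_absolutelyContinuous hp hPQ, EReal.coe_mul_top_of_pos hp1,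
      of_not_not (mt (absolutelyContinuous_of_hellingerIntegral_ne_top hp) hPQ)]
    rfl

lemma exp_mul_renyiDiv (hp : p ≠ 1) (P Q : Measure Ω) :
    EReal.exp ((((p - 1) / p : ℝ) : EReal) * renyiDiv p P Q) =
      hellingerIntegral p P Q ^ (1 / p) := by
  have hp1 : p - 1 ≠ 0 := sub_ne_zero.2 hp
  have coefficient : (p - 1) / p * (1 / (p - 1)) = 1 / p := by field_simp
  rw [renyiDiv, ← mul_assoc, ← EReal.coe_mul, coefficient, ← ENNReal.log_rpow, ENNReal.exp_log,
    hellingerIntegral]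

lemma hellingerBound_phiDiv [SigmaFinite P] [IsProbabilityMeasure Q] (hp : 1 < p) (ρ : ℝ)
    (L : ℝ≥0∞) :
    hellingerBound p ρ L (phiDiv (hellingerFun p) P Q) =
      ρ * (1 - ((L ^ ((p - 1) / p) * hellingerIntegral p P Q ^ (1 / p) : ℝ≥0∞) : EReal)) := by
  rw [hellingerBound, mul_phiDiv_hellingerFun_add_one hp, EReal.toENNReal_coe]

lemma renyiBound_renyiDiv [SigmaFinite P] [IsProbabilityMeasure Q] (hp : 1 < p) (ρ : ℝ)
    (L : ℝ≥0∞) :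
    renyiBound p ρ L (renyiDiv p P Q) = hellingerBound p ρ L (phiDiv (hellingerFun p) P Q) := by
  rw [renyiBound, exp_mul_renyiDiv hp.ne', hellingerBound_phiDiv hp]

lemma setLIntegral_le_measure_rpow_mul_lintegral_rpow {μ : Measure Ω} {f : Ω → ℝ≥0∞}
    (hf : AEMeasurable f μ) (hp : 1 ≤ p) (E : Set Ω) :
    ∫⁻ x in E, f x ∂μ ≤ μ E ^ ((p - 1) / p) * (∫⁻ x, f x ^ p ∂μ) ^ (1 / p) := by
  have hp0 : p ≠ 0 := by linarith
  have exponent : 1 - 1 / p = (p - 1) / p := by field_simp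
  have holder := eLpNorm'_le_eLpNorm'_mul_rpow_measure_univ zero_lt_one hp
    (hf.restrict (s := E)).aestronglyMeasurable
  simp only [eLpNorm', enorm_eq_self, ENNReal.rpow_one, Measure.restrict_apply_univ,
    div_one, exponent] at holder
  rw [mul_comm]
  exact holder.trans (by gcongr; exact Measure.restrict_le_self)

lemma measure_le_rpow_mul_hellingerIntegral_rpow [SigmaFinite P] [SigmaFinite Q] (hp : 1 < p)
    {L : ℝ≥0∞} (h : L ≠ 0 ∨ P ≪ Q) {E : Set Ω} (hE : Q E ≤ L) :
    P E ≤ L ^ ((p - 1) / p) * hellingerIntegral p P Q ^ (1 / p) := by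
  have hp0 : 0 < p := by linarith
  have hp1 : 0 < p - 1 := sub_pos.2 hp
  by_cases hPQ : P ≪ Q
  · rw [hellingerIntegral_eq_lintegral_rnDeriv_rpow hp0 hPQ, ← Measure.setLIntegral_rnDeriv hPQ]
    refine (setLIntegral_le_measure_rpow_mul_lintegral_rpow (by fun_prop) hp.le E).trans ?_
    gcongr
  · have hL : L ^ ((p - 1) / p) ≠ 0 := by
      simp [ENNReal.rpow_eq_zero_iff, h.resolve_right hPQ, (div_pos hp1 hp0).le]
    rw [of_not_not (mt (absolutelyContinuous_of_hellingerIntegral_ne_top hp) hPQ),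
      ENNReal.top_rpow_of_pos (one_div_pos.2 hp0), ENNReal.mul_top hL]
    exact le_top

end Divergences

section Markov

variable {Ω : Type*} [MeasurableSpace Ω] {P : Measure Ω} [IsProbabilityMeasure P]

lemma mul_one_sub_measure_lt_le_lintegral {f : Ω → ℝ≥0∞} (hf : AEMeasurable f P) (r : ℝ≥0∞) :
    r * (1 - P {x | f x < r}) ≤ ∫⁻ x, f x ∂P := by
  have compl_mass : 1 - P {x | f x < r} ≤ P {x | r ≤ f x} := by
    simpa [Set.compl_ofPred, add_comm] using measure_univ_le_add_compl (μ := P) {x | f x < r}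
  exact (mul_le_mul_right compl_mass r).trans (mul_meas_ge_le_lintegral₀ hf r)

lemma coe_mul_one_sub_le {ρ : ℝ} (hρ : 0 ≤ ρ) (K : ℝ≥0∞) :
    (ρ : EReal) * (1 - (K : EReal)) ≤ ((ENNReal.ofReal ρ * (1 - K) : ℝ≥0∞) : EReal) := by
  rw [EReal.coe_ennreal_mul, EReal.coe_ennreal_ofReal, max_eq_left hρ]
  refine mul_le_mul_of_nonneg_left ?_ (EReal.coe_nonneg.2 hρ)
  rw [EReal.sub_le_iff_le_add (.inl (EReal.coe_ennreal_ne_bot _)) (.inr (by simp))]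
  exact_mod_cast le_tsub_add

lemma mul_one_sub_le_lintegral {ρ : ℝ} (hρ : 0 ≤ ρ) {f : Ω → ℝ≥0} (hf : AEMeasurable f P)
    {K : ℝ≥0∞} (hK : P {x | (f x : ℝ) < ρ} ≤ K) :
    (ρ : EReal) * (1 - (K : EReal)) ≤ ((∫⁻ x, (f x : ℝ≥0∞) ∂P : ℝ≥0∞) : EReal) := by
  refine (coe_mul_one_sub_le hρ K).trans (EReal.coe_ennreal_le_coe_ennreal_iff.2 ?_)
  have hset : {x | (f x : ℝ≥0∞) < ENNReal.ofReal ρ} = {x | (f x : ℝ) < ρ} := by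
    ext x
    simp [ENNReal.ofReal, Real.lt_toNNReal_iff_coe_lt]
  calc ENNReal.ofReal ρ * (1 - K)
      ≤ ENNReal.ofReal ρ * (1 - P {x | (f x : ℝ≥0∞) < ENNReal.ofReal ρ}) := by
        rw [hset]
        gcongr
    _ ≤ ∫⁻ x, (f x : ℝ≥0∞) ∂P := mul_one_sub_measure_lt_le_lintegral hf.coe_nnreal_ennreal _

end Markov

section Risk

variable {𝓦 𝓧 𝓥 : Type*} [MeasurableSpace 𝓦] [MeasurableSpace 𝓧] [MeasurableSpace 𝓥]

lemma renyiBound_renyiInfo {p : ℝ} (hp : 1 < p) (ρ : ℝ) (L : ℝ≥0∞) (P : Measure (𝓦 × 𝓧))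
    [IsProbabilityMeasure P] :
    renyiBound p ρ L (renyiInfo p P) = hellingerBound p ρ L (hellingerInfo p P) :=
  renyiBound_renyiDiv hp ρ L

lemma prod_loss_lt_le_smallBall (PW : Measure 𝓦) [SFinite PW] (PX : Measure 𝓧)
    [IsProbabilityMeasure PX] {ℓ : 𝓦 × 𝓥 → ℝ≥0} (hℓ : Measurable ℓ) (ρ : ℝ) {ψ : 𝓧 → 𝓥}
    (hψ : Measurable ψ) :
    PW.prod PX {z | (ℓ (z.1, ψ z.2) : ℝ) < ρ} ≤ smallBall PW ℓ ρ := by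
  rw [Measure.prod_apply_symm (measurableSet_lt (by fun_prop) measurable_const)]
  calc ∫⁻ y, PW {w | (ℓ (w, ψ y) : ℝ) < ρ} ∂PX
      ≤ ∫⁻ _, smallBall PW ℓ ρ ∂PX :=
        lintegral_mono fun y => le_iSup (fun v => PW {w | (ℓ (w, v) : ℝ) < ρ}) (ψ y)
    _ = smallBall PW ℓ ρ := by simp

lemma hellingerBound_le_lintegral_loss (P : Measure (𝓦 × 𝓧)) [IsProbabilityMeasure P]
    {ℓ : 𝓦 × 𝓥 → ℝ≥0} (hℓ : Measurable ℓ) {p ρ : ℝ} (hp : 1 < p) (hρ : 0 ≤ ρ)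
    (h : smallBall P.fst ℓ ρ ≠ 0 ∨ P ≪ P.fst.prod P.snd) {ψ : 𝓧 → 𝓥} (hψ : Measurable ψ) :
    hellingerBound p ρ (smallBall P.fst ℓ ρ) (hellingerInfo p P) ≤
      ((∫⁻ z, (ℓ (z.1, ψ z.2) : ℝ≥0∞) ∂P : ℝ≥0∞) : EReal) := by
  rw [hellingerInfo, phiMutualInfo, hellingerBound_phiDiv hp]
  exact mul_one_sub_le_lintegral hρ (by fun_prop) <|
    measure_le_rpow_mul_hellingerIntegral_rpow hp h <|
      prod_loss_lt_le_smallBall P.fst P.snd hℓ ρ hψ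

lemma le_bayesRiskDet_of_forall_le_estimatorRisk
    {PW : Measure 𝓦} {κ : Kernel 𝓦 𝓧} {ℓ : 𝓦 × 𝓥 → ℝ≥0} {b : EReal}
    (h : ∀ φ : 𝓧 → 𝓥, Measurable φ → b ≤ (estimatorRisk PW κ ℓ φ : EReal)) :
    b ≤ (bayesRiskDet PW κ ℓ : EReal) := by
  have toENNReal_le : b.toENNReal ≤ bayesRiskDet PW κ ℓ := le_iInf₂ fun φ hφ => by
    simpa only [EReal.toENNReal_coe] using EReal.toENNReal_le_toENNReal (h φ hφ)
  calc b ≤ (b.toENNReal : EReal) := EReal.coe_toENNReal_eq_max ▸ le_max_right _ _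
    _ ≤ (bayesRiskDet PW κ ℓ : EReal) := EReal.coe_ennreal_le_coe_ennreal_iff.2 toENNReal_le

lemma absolutelyContinuous_prod_marginals_map {A B : Type*} [MeasurableSpace A] [MeasurableSpace B]
    {P : Measure (𝓦 × 𝓧)} [SFinite P] {f : 𝓦 → A} {g : 𝓧 → B} (hf : Measurable f)
    (hg : Measurable g) (h : P ≪ P.fst.prod P.snd) :
    P.map (Prod.map f g) ≪ (P.map (Prod.map f g)).fst.prod (P.map (Prod.map f g)).snd := by
  have hfst : (P.map (Prod.map f g)).fst = P.fst.map f := by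
    rw [Measure.fst, Measure.fst, Measure.map_map measurable_fst (by fun_prop),
      Measure.map_map hf measurable_fst, Prod.map_fst']
  have hsnd : (P.map (Prod.map f g)).snd = P.snd.map g := by
    rw [Measure.snd, Measure.snd, Measure.map_map measurable_snd (by fun_prop),
      Measure.map_map hg measurable_snd, Prod.map_snd']
  have : SFinite P.fst := by unfold Measure.fst; infer_instance
  have : SFinite P.snd := by unfold Measure.snd; infer_instance
  rw [hfst, hsnd, Measure.map_prod_map _ _ hf hg]
  exact h.map (hf.prodMap hg)

section EstimatorLaw

variable (PW : Measure 𝓦) [SFinite PW] (κ : Kernel 𝓦 𝓧) [IsSFiniteKernel κ] {φ : 𝓧 → 𝓥}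

lemma jointLaw_map (hφ : Measurable φ) :
    jointLaw PW (κ.map φ) = (jointLaw PW κ).map (Prod.map id φ) :=
  Measure.compProd_map hφ

lemma estimatorLaw_eq_jointLaw_map (hφ : Measurable φ) :
    estimatorLaw PW κ φ = jointLaw PW (κ.map φ) :=
  (jointLaw_map PW κ hφ).symm

lemma estimatorRisk_eq_estimatorRisk_map_id {ℓ : 𝓦 × 𝓥 → ℝ≥0} (hℓ : Measurable ℓ)
    (hφ : Measurable φ) : estimatorRisk PW κ ℓ φ = estimatorRisk PW (κ.map φ) ℓ id := by
  rw [estimatorRisk, estimatorRisk, jointLaw_map PW κ hφ,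
    lintegral_map (by fun_prop) (by fun_prop)]
  rfl

end EstimatorLaw

variable (PW : Measure 𝓦) [IsProbabilityMeasure PW] (κ : Kernel 𝓦 𝓧) [IsMarkovKernel κ]
  {φ : 𝓧 → 𝓥}

instance : IsProbabilityMeasure (jointLaw PW κ) :=
  inferInstanceAs (IsProbabilityMeasure (PW ⊗ₘ κ))

lemma hellingerBound_le_estimatorRisk {ℓ : 𝓦 × 𝓥 → ℝ≥0} (hℓ : Measurable ℓ) {p ρ : ℝ}
    (hp : 1 < p) (hρ : 0 ≤ ρ)
    (h : smallBall PW ℓ ρ ≠ 0 ∨ jointLaw PW κ ≪ (jointLaw PW κ).fst.prod (jointLaw PW κ).snd)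
    (hφ : Measurable φ) :
    hellingerBound p ρ (smallBall PW ℓ ρ) (hellingerInfo p (jointLaw PW κ)) ≤
      (estimatorRisk PW κ ℓ φ : EReal) := by
  have hfst : (jointLaw PW κ).fst = PW := Measure.fst_compProd PW κ
  have bound := hellingerBound_le_lintegral_loss (jointLaw PW κ) hℓ (ρ := ρ) hp hρ
    (h.imp_left fun hL => by rwa [hfst]) hφ
  rwa [hfst] at bound

end Risk

end BayesLower

theorem mainTheorem3
    {𝓦 𝓧 𝓥 : Type*} [MeasurableSpace 𝓦] [MeasurableSpace 𝓧] [MeasurableSpace 𝓥]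
    (PW : Measure 𝓦) [IsProbabilityMeasure PW]
    (κ : Kernel 𝓦 𝓧) [IsMarkovKernel κ]
    (ℓ : 𝓦 × 𝓥 → ℝ≥0) (hℓ : Measurable ℓ)
    (p ρ : ℝ) (hp : 1 < p) (hρ : 0 < ρ)
    (h : BayesLower.smallBall PW ℓ ρ ≠ 0 ∨
      BayesLower.jointLaw PW κ ≪
        (BayesLower.jointLaw PW κ).fst.prod (BayesLower.jointLaw PW κ).snd) :
    -- the bound on the Bayes risk through the Hellinger information
    (BayesLower.hellingerBound p ρ (BayesLower.smallBall PW ℓ ρ)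
        (BayesLower.hellingerInfo p (BayesLower.jointLaw PW κ))
      ≤ (BayesLower.bayesRiskDet PW κ ℓ : EReal)) ∧
    -- the same bound through Rényi's divergence
    (BayesLower.renyiBound p ρ (BayesLower.smallBall PW ℓ ρ)
        (BayesLower.renyiInfo p (BayesLower.jointLaw PW κ))
      ≤ (BayesLower.bayesRiskDet PW κ ℓ : EReal)) ∧
    -- the two bounds for a fixed estimator
    (∀ φ : 𝓧 → 𝓥, Measurable φ →
      BayesLower.hellingerBound p ρ (BayesLower.smallBall PW ℓ ρ)
          (BayesLower.hellingerInfo p (BayesLower.estimatorLaw PW κ φ))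
        ≤ (BayesLower.estimatorRisk PW κ ℓ φ : EReal) ∧
      BayesLower.renyiBound p ρ (BayesLower.smallBall PW ℓ ρ)
          (BayesLower.renyiInfo p (BayesLower.estimatorLaw PW κ φ))
        ≤ (BayesLower.estimatorRisk PW κ ℓ φ : EReal)) := by
  have hrisk := fun (φ : 𝓧 → 𝓥) (hφ : Measurable φ) =>
    BayesLower.hellingerBound_le_estimatorRisk PW κ hℓ hp hρ.le h hφ
  rw [BayesLower.renyiBound_renyiInfo hp]
  refine ⟨BayesLower.le_bayesRiskDet_of_forall_le_estimatorRisk hrisk,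
    BayesLower.le_bayesRiskDet_of_forall_le_estimatorRisk hrisk, fun φ hφ => ?_⟩
  have := Kernel.IsMarkovKernel.map κ hφ
  rw [BayesLower.estimatorLaw_eq_jointLaw_map PW κ hφ, BayesLower.renyiBound_renyiInfo hp,
    BayesLower.estimatorRisk_eq_estimatorRisk_map_id PW κ hℓ hφ, and_self_iff]
  refine BayesLower.hellingerBound_le_estimatorRisk PW (κ.map φ) hℓ hp hρ.le
    (h.imp_right fun hac => ?_) measurable_id
  rw [BayesLower.jointLaw_map PW κ hφ]
  exact BayesLower.absolutelyContinuous_prod_marginals_map measurable_id hφ hac
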